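/- Let $n$ be a positive integer. A labeled $n$-multigraph is a finite multigraph $G$ with vertex set $\{0,1,\dots,n\}$, without loops and with at most one edge $0k$ for each $k\in\{1,\dots,n\}$, in which, for $1\le i<j\le n$, every edge between $i$ and $j$ is labeled by a nonzero complex number $\zeta$ (such an edge is denoted $ij^{\zeta}$), no two edges with the same endpoints having the same label. A forest in $G$ is a set of edges containing no cycle, where two distinct edges with the same endpoints count as a cycle. A spanning forest is increasing if on every path that starts at the smallest vertex of one of its components the vertices form an increasing sequence; $\mathrm{isf}_m(G)$ is the number of increasing spanning forests of $G$ with $m$ edges. Let $L(G)$ be the lattice of all intersections (including $\mathbb{C}^n$ itself), ordered by reverse inclusion, of the hyperplanes $x_i=\gamma x_j$ for the edges $ij^{\gamma}$ of $G$ with $1\le i<j\le n$, and $x_k=0$ for the edges $0k$ of $G$. Let $\rho$ be its rank function. A set $S$ of atoms of $L(G)$ is independent if $\rho(\bigvee S)=|S|$; a circuit is a minimal dependent set of atoms. Fix any total order on the atoms. A broken circuit is a circuit with its smallest atom removed, an NBC set is a set of atoms containing no broken circuit, and $\mathrm{nbc}_m(L(G))$ is the number of NBC sets with $m$ atoms.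 Call $G$ perfectly labeled if 1. whenever $1\le i<j<k\le n$ and $G$ has edges $ik^{\alpha}$ and $jk^{\beta}$, it also has an edge $ij^{\alpha/\beta}$; 2. whenever $1\le j<k\le n$ and $G$ has edges $jk^{\gamma}$ and $jk^{\epsilon}$ with $\gamma\ne\epsilon$, it also has the edge $0j$; 3. whenever $1\le j<k\le n$ and $G$ has edges $jk^{\gamma}$ and $0k$, it also has the edge $0j$. Then, for every total order on the atoms, $\mathrm{isf}_m(G)\le \mathrm{nbc}_m(L(G))$ for all $m\ge 0$. Moreover, $\mathrm{isf}_m(G)=\mathrm{nbc}_m(L(G))$ for all $m\ge0$ if and only if $G$ is perfectly labeled. -/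

import Mathlib

noncomputable section

/-! ### Increasing forests in a multigraph with linearly ordered vertices -/

namespace Graph

variable {V E : Type*}

/-- The multigraph `H` contains a cycle: a closed walk `v 0, e 0, v 1, e 1, …, v k = v 0` with
`k ≥ 1` edges whose vertices `v 0, …, v (k-1)` are distinct and whose edges are distinct.
In particular two different edges with the same two ends form a cycle (`k = 2`). -/
def HasCycle (H : Graph V E) : Prop :=
  ∃ (k : ℕ) (v : ℕ → V) (e : ℕ → E), 1 ≤ k ∧
    (∀ i < k, H.IsLink (e i) (v i) (v (i + 1))) ∧ v k = v 0 ∧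
    Set.InjOn v (Set.Iio k) ∧ Set.InjOn e (Set.Iio k)

/-- A forest is a multigraph without cycles. -/
def IsForest (H : Graph V E) : Prop := ¬ H.HasCycle

variable [LinearOrder V]

/-- `r` is the root of its connected component, that is, its smallest vertex. -/
def IsRoot (H : Graph V E) (r : V) : Prop :=
  r ∈ H.vertexSet ∧ ∀ w, Relation.ReflTransGen H.Adj r w → r ≤ w

/-- A forest is increasing if, in each of its components, the labels on any path
`r, l₁, l₂, …` beginning at the root `r` form an increasing sequence. -/
def IsIncreasingForest (H : Graph V E) : Prop :=
  H.IsForest ∧ ∀ (r : V) (l : List V), H.IsRoot r →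
    (r :: l).IsChain H.Adj → (r :: l).Nodup → (r :: l).IsChain (· < ·)

end Graph

/-! ### Labeled multigraphs -/

/-- A labeled `n`-multigraph: a finite loopless multigraph with vertex set `{0, 1, …, n}`, having at
most one edge `0k` for each nonzero `k`, in which every edge between nonzero vertices carries a
nonzero complex label, edges with the same nonzero endpoints having different labels.
(The value of `label` on the edges at the vertex `0` plays no role.) -/
structure LabeledMultigraph (n : ℕ) (E : Type*) extends Graph (Fin (n + 1)) E where
  label : E → ℂ
  vertexSet_eq : vertexSet = Set.univ
  edgeSet_finite : edgeSet.Finite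
  loopless : ∀ e x, ¬ IsLink e x x
  zero_edge_unique : ∀ e f k, IsLink e 0 k → IsLink f 0 k → e = f
  label_ne_zero : ∀ e i j, i ≠ 0 → j ≠ 0 → IsLink e i j → label e ≠ 0
  label_injective : ∀ e f i j, i ≠ 0 → j ≠ 0 → IsLink e i j → IsLink f i j →
    label e = label f → e = f

/-! ### Intersection lattices of linear arrangements -/

/-- The intersection lattice of a set `A` of hyperplanes through the origin: all intersections of
subfamilies of `A` (the empty one giving the whole space), ordered by reverse inclusion. -/
def IntersectionLattice {K W : Type*} [Field K] [AddCommGroup W] [Module K W]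
    (A : Set (Submodule K W)) : Type _ :=
  {X : Submodule K W // ∃ B ⊆ A, X = sInf B}

namespace IntersectionLattice

variable {K W : Type*} [Field K] [AddCommGroup W] [Module K W] {A : Set (Submodule K W)}

/-- The order by reverse inclusion. -/
instance : PartialOrder (IntersectionLattice A) where
  le X Y := Y.1 ≤ X.1
  le_refl X := le_refl X.1
  le_trans _ _ _ h₁ h₂ := le_trans h₂ h₁
  le_antisymm _ _ h₁ h₂ := Subtype.ext (le_antisymm h₂ h₁)

/-- The join of a family of elements is their intersection. -/
instance : SupSet (IntersectionLattice A) where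
  sSup s := ⟨sInf (Subtype.val '' s), by
    refine ⟨{H | H ∈ A ∧ ∃ X ∈ s, X.1 ≤ H}, fun H hH => hH.1, le_antisymm ?_ ?_⟩
    · refine le_sInf ?_
      rintro H ⟨_, X, hX, hXH⟩
      exact (sInf_le (Set.mem_image_of_mem _ hX)).trans hXH
    · refine le_sInf ?_
      rintro _ ⟨X, hX, rfl⟩
      obtain ⟨B, hB, hXB⟩ := X.2
      rw [hXB]
      refine le_sInf fun H hH => sInf_le ⟨hB hH, X, hX, ?_⟩
      rw [hXB]
      exact sInf_le hH⟩

/-- Joins are intersections; meets, top and bottom are the ones determined by the order. -/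
instance : CompleteLattice (IntersectionLattice A) :=
  completeLatticeOfSup _ fun _ =>
    ⟨fun X hX => by
      refine sInf_le (a := X.1) ?_
      exact Set.mem_image_of_mem Subtype.val hX, fun Y hY => by
      refine le_sInf (a := Y.1) ?_
      rintro _ ⟨X, hX, rfl⟩
      exact hY hX⟩

end IntersectionLattice

/-! ### Broken circuits in a (finite, geometric) lattice -/

section BrokenCircuits

/-- The atoms of a lattice. -/
def LatticeAtom (L : Type*) [CompleteLattice L] : Type _ := {a : L // IsAtom a}

variable {L : Type*} [CompleteLattice L]

/-- A set `S` of atoms is independent if the rank of its join equals `|S|`.  The rank of an element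
is its height, the maximal length of a chain from the bottom element to it. -/
def AtomIndependent (S : Set (LatticeAtom L)) : Prop :=
  Order.height (⨆ a ∈ S, a.1) = S.encard

/-- A circuit is a minimal dependent set of atoms. -/
def AtomCircuit (C : Set (LatticeAtom L)) : Prop :=
  Minimal (fun S => ¬ AtomIndependent S) C

/-- With respect to the strict total order `prec` on the atoms, a broken circuit is a circuit with
its smallest atom removed. -/
def IsBrokenCircuit (prec : LatticeAtom L → LatticeAtom L → Prop)
    (S : Set (LatticeAtom L)) : Prop :=
  ∃ C, AtomCircuit C ∧ ∃ a ∈ C, (∀ b ∈ C, b ≠ a → prec a b) ∧ S = C \ {a}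

/-- An NBC set is a set of atoms that contains no broken circuit. -/
def IsNBC (prec : LatticeAtom L → LatticeAtom L → Prop) (S : Set (LatticeAtom L)) : Prop :=
  ∀ T ⊆ S, ¬ IsBrokenCircuit prec T

/-- The number of NBC sets with `m` atoms. -/
def nbcCount (prec : LatticeAtom L → LatticeAtom L → Prop) (m : ℕ) : ℕ :=
  {S : Set (LatticeAtom L) | IsNBC prec S ∧ S.encard = m}.ncard

end BrokenCircuits

namespace LabeledMultigraph

variable {n : ℕ} {E : Type*} (G : LabeledMultigraph n E)

/-- `G.HasEdge i j γ`: there is an edge with label `γ` between the nonzero vertices corresponding to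
`i j : Fin n`.  Here and below `k : Fin n` stands for the nonzero vertex `k.succ`. -/
def HasEdge (i j : Fin n) (γ : ℂ) : Prop :=
  ∃ e, G.IsLink e i.succ j.succ ∧ G.label e = γ

/-- `G.HasZeroEdge k`: there is an edge between `0` and the nonzero vertex `k.succ`. -/
def HasZeroEdge (k : Fin n) : Prop := ∃ e, G.IsLink e 0 k.succ

/-- The number of increasing spanning forests of `G` with `m` edges.  A spanning subgraph is given
by its edge set `F`. -/
def isf (m : ℕ) : ℕ :=
  {F : Set E | F ⊆ G.edgeSet ∧ (G.toGraph.restrict F).IsIncreasingForest ∧ F.encard = m}.ncard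

/-- The hyperplane arrangement in `ℂⁿ` consisting of the hyperplanes `x_i = γ x_j` for the edges
`ij` (`0 < i < j`) with label `γ`, and `x_k = 0` for the edges `0k`. -/
def arrangement : Set (Submodule ℂ (Fin n → ℂ)) :=
  {H | ∃ (i j : Fin n) (γ : ℂ), i < j ∧ G.HasEdge i j γ ∧
      H = LinearMap.ker ((LinearMap.proj i : (Fin n → ℂ) →ₗ[ℂ] ℂ) - γ • LinearMap.proj j)} ∪
  {H | ∃ k : Fin n, G.HasZeroEdge k ∧ H = LinearMap.ker (LinearMap.proj k : (Fin n → ℂ) →ₗ[ℂ] ℂ)}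

/-- The intersection lattice `L(G)`. -/
abbrev lattice : Type := IntersectionLattice G.arrangement

/-- Perfectly labeled multigraphs. -/
def IsPerfectlyLabeled : Prop :=
  (∀ (i j k : Fin n) (α β : ℂ), i < j → j < k → G.HasEdge i k α → G.HasEdge j k β →
    G.HasEdge i j (α / β)) ∧
  (∀ (j k : Fin n) (γ ε : ℂ), j < k → G.HasEdge j k γ → G.HasEdge j k ε → γ ≠ ε →
    G.HasZeroEdge j) ∧
  (∀ (j k : Fin n) (γ : ℂ), j < k → G.HasEdge j k γ → G.HasZeroEdge k → G.HasZeroEdge j)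

end LabeledMultigraph

end

/-!
Call the *block* of a vertex `k` the set of edges of `G` whose larger end is `k`.  A set of edges is
an increasing forest if and only if it meets each block at most once
(`Graph.AtMostOneLowerEdge.isIncreasingForest`, `Graph.IsIncreasingForest.atMostOneLowerEdge`), so
that `G.isf m` counts the sets of `m` edges with this property.

The edges correspond to the atoms of the lattice, and each edge is represented by the linear form
`x_i - c x_j` (with `x_0 = 0`) that defines its hyperplane.  The rank of an intersection of
hyperplanes is its codimension (`IntersectionLattice.height_eq_finrank`), hence independence of atoms
is linear independence of these forms, and a set of atoms is NBC if and only if no form is a linear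
combination of members of the set that come after it
(`IntersectionLattice.isNBC_iff_vectorNBC`).

By Whitney's broken circuit theorem (`sum_neg_one_pow_ncard_eq`) the number of NBC sets with `m`
elements is, up to sign, the sum of `(-1) ^ |S|` over all sets `S` of rank `m`, so it does not depend
on the order.  It may thus be computed with an order that lists the blocks in turn.  For such an
order a set meeting each block at most once is NBC (`vectorNBC_of_injOn`), because the form of an
edge with larger end `k` involves `x_k` while the forms of earlier blocks do not.  This gives the
inequality.  Equality for all `m` (equivalently, for `m = 2`) means that, conversely, no two edges of
one block form an NBC set, that is, that the plane of their forms contains the form of an edge of an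
earlier block.  Up to scalars that plane contains a single form without `x_k`, and the three ways to
choose two edges of a block give the three conditions for a perfect labeling
(`LabeledMultigraph.isPerfectlyLabeled_iff`).
-/

noncomputable section

/-! ### No-broken-circuit sets of a family of vectors -/

/-- A nonempty finite set has a first element with respect to a strict total order. -/
theorem Set.Finite.exists_first {α : Type*} (r : α → α → Prop) [IsStrictTotalOrder α r] {S : Set α}
    (hf : S.Finite) (hS : S.Nonempty) : ∃ a ∈ S, ∀ b ∈ S, b ≠ a → r a b := by
  classical
  let _ := linearOrderOfSTO r
  obtain ⟨a, ha, h⟩ := Set.exists_min_image S id hf hS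
  exact ⟨a, ha, fun b hb hba => lt_of_le_of_ne (h b hb) (Ne.symm hba)⟩

section VectorNBC

open Module Submodule

variable (K : Type*) {M α : Type*} [Field K] [AddCommGroup M] [Module K M]

/-- The set `S` is NBC for the family of vectors `v` and the strict order `r` on the indices: no
vector `v a` is a linear combination of those members of `S` that come after `a`.  For a total order
this says that `S` contains no broken circuit of the linear matroid of `v`, a form of the condition
that does not mention circuits. -/
def VectorNBC (r : α → α → Prop) (v : α → M) (S : Set α) : Prop :=
  ∀ a, v a ∉ span K (v '' {s ∈ S | r a s})

variable {K} {r : α → α → Prop} {v : α → M} {S : Set α}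

theorem mem_span_of_minimal_not_linearIndepOn {C : Set α}
    (hC : Minimal (fun S => ¬ LinearIndepOn K v S) C) {a : α} (ha : a ∈ C) :
    v a ∈ span K (v '' (C \ {a})) := by
  have h : LinearIndepOn K v (C \ {a}) := by
    by_contra h
    exact (hC.le_of_le h Set.sdiff_subset ha).2 rfl
  by_contra hn
  refine hC.prop ?_
  simpa [Set.insert_eq_of_mem ha] using h.insert hn

/-- Every dependent set contains a circuit, of which the first element is singled out. -/
theorem exists_minimal_not_linearIndepOn_first [Finite α] (r : α → α → Prop)
    [IsStrictTotalOrder α r] (hS : ¬ LinearIndepOn K v S) :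
    ∃ C ⊆ S, Minimal (fun S => ¬ LinearIndepOn K v S) C ∧ ∃ a ∈ C, ∀ b ∈ C, b ≠ a → r a b := by
  obtain ⟨C, hCS, hC⟩ :=
    exists_minimal_le_of_wellFoundedLT (fun S => ¬ LinearIndepOn K v S) S hS
  refine ⟨C, hCS, hC, Set.Finite.exists_first r C.toFinite ?_⟩
  rw [Set.nonempty_iff_ne_empty]
  rintro rfl
  exact hC.prop (linearIndepOn_empty K v)

theorem VectorNBC.linearIndepOn [Finite α] [IsStrictTotalOrder α r] (h : VectorNBC K r v S) :
    LinearIndepOn K v S := by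
  by_contra hS
  obtain ⟨C, hCS, hC, a, ha, hmin⟩ := exists_minimal_not_linearIndepOn_first r hS
  have hsub : C \ {a} ⊆ {s ∈ S | r a s} := fun b hb => ⟨hCS hb.1, hmin b hb.1 hb.2⟩
  exact h a (span_mono (Set.image_mono hsub) (mem_span_of_minimal_not_linearIndepOn hC ha))

theorem LinearIndepOn.finrank_span_eq_ncard [Finite α] (h : LinearIndepOn K v S) :
    finrank K (span K (v '' S)) = S.ncard := by
  classical
  have := Fintype.ofFinite S
  rw [Set.image_eq_range, finrank_span_eq_card h, ← Nat.card_eq_fintype_card, Nat.card_coe_set_eq]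

theorem linearIndepOn_iff_finrank_span_eq_ncard [Finite α] :
    LinearIndepOn K v S ↔ finrank K (span K (v '' S)) = S.ncard := by
  have := Fintype.ofFinite S
  rw [LinearIndepOn, linearIndependent_iff_card_eq_finrank_span, Set.image_eq_range, Set.finrank,
    ← Nat.card_eq_fintype_card, Nat.card_coe_set_eq, eq_comm]

/-- Insert `a` into `S`, or remove it if it is already there. -/
def Set.toggle (a : α) (S : Set α) : Set α := symmDiff S {a}

theorem Set.mem_toggle_of_ne {a b : α} (h : b ≠ a) : b ∈ Set.toggle a S ↔ b ∈ S := by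
  simp [Set.toggle, Set.mem_symmDiff, h]

theorem Set.mem_toggle_self {a : α} : a ∈ Set.toggle a S ↔ a ∉ S := by
  simp [Set.toggle, Set.mem_symmDiff]

theorem Set.toggle_toggle (a : α) (S : Set α) : Set.toggle a (Set.toggle a S) = S := by
  simp [Set.toggle]

theorem neg_one_pow_ncard_toggle [Finite α] (a : α) (S : Set α) :
    (-1 : ℤ) ^ S.ncard + (-1) ^ (Set.toggle a S).ncard = 0 := by
  by_cases h : a ∈ S
  · have : Set.toggle a S = S \ {a} := by
      ext b; by_cases hb : b = a
      · subst hb; simp [Set.mem_toggle_self, h]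
      · simp [Set.mem_toggle_of_ne hb, hb]
    rw [this, ← Set.ncard_sdiff_singleton_add_one h, pow_succ]
    ring
  · have : Set.toggle a S = insert a S := by
      ext b; by_cases hb : b = a
      · subst hb; simp [Set.mem_toggle_self, h]
      · simp [Set.mem_toggle_of_ne hb, hb]
    rw [this, Set.ncard_insert_of_notMem h, pow_succ]
    ring

theorem span_image_toggle {a : α} (h : v a ∈ span K (v '' (S \ {a}))) :
    span K (v '' Set.toggle a S) = span K (v '' S) := by
  have key : ∀ T : Set α, S \ {a} ⊆ T → T ⊆ insert a S →
      span K (v '' T) = span K (v '' (S \ {a})) := by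
    refine fun T h₁ h₂ => le_antisymm (span_le.2 ?_) (span_mono (Set.image_mono h₁))
    rintro _ ⟨b, hb, rfl⟩
    by_cases hba : b = a
    · exact hba ▸ h
    · exact subset_span ⟨b, ⟨(h₂ hb).resolve_left hba, hba⟩, rfl⟩
  rw [key S Set.sdiff_subset (Set.subset_insert _ _), key]
  · intro b hb
    rw [Set.mem_toggle_of_ne hb.2]
    exact hb.1
  · intro b hb
    by_cases hba : b = a
    · exact Or.inl hba
    · exact Or.inr ((Set.mem_toggle_of_ne hba).1 hb)

/-- The index `a` is the last one whose vector is a combination of later members of `S`. -/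
def IsLastDependent (K : Type*) [Field K] [Module K M] (r : α → α → Prop) (v : α → M) (S : Set α)
    (a : α) : Prop :=
  v a ∈ span K (v '' {s ∈ S | r a s}) ∧ ∀ b, r a b → v b ∉ span K (v '' {s ∈ S | r b s})

theorem exists_isLastDependent [Finite α] [IsStrictTotalOrder α r] (h : ¬ VectorNBC K r v S) :
    ∃ a, IsLastDependent K r v S a := by
  simp only [VectorNBC, not_forall, not_not] at h
  have : IsStrictTotalOrder α (Function.swap r) := inferInstance
  obtain ⟨a, ha, hmax⟩ := Set.Finite.exists_first (Function.swap r)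
    (Set.toFinite {a | v a ∈ span K (v '' {s ∈ S | r a s})}) h
  refine ⟨a, ha, fun b hab hb => ?_⟩
  have hba : b ≠ a := by
    rintro rfl
    exact irrefl_of r b hab
  exact irrefl_of r a (trans_of r hab (hmax b hb hba))

theorem IsLastDependent.unique [IsStrictTotalOrder α r] {a b : α} (ha : IsLastDependent K r v S a)
    (hb : IsLastDependent K r v S b) : a = b := by
  rcases trichotomous_of r a b with h | h | h
  · exact (ha.2 b h hb.1).elim
  · exact h
  · exact (hb.2 a h ha.1).elim

theorem IsLastDependent.toggle [IsStrictTotalOrder α r] {a : α} (ha : IsLastDependent K r v S a) :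
    IsLastDependent K r v (Set.toggle a S) a := by
  -- Toggling `a` does not affect the members after `b` when `b` is `a` or comes after it.
  have key : ∀ b, ¬ r b a → {s ∈ Set.toggle a S | r b s} = {s ∈ S | r b s} := by
    intro b hb
    ext s
    by_cases hs : s = a
    · subst hs; simp [hb]
    · simp [Set.mem_toggle_of_ne hs]
  refine ⟨by rw [key a (irrefl_of r a)]; exact ha.1, fun b hb => ?_⟩
  rw [key b fun h => irrefl_of r a (trans_of r hb h)]
  exact ha.2 b hb

theorem IsLastDependent.not_vectorNBC {a : α} (ha : IsLastDependent K r v S a) :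
    ¬ VectorNBC K r v S := fun h => h a ha.1

theorem IsLastDependent.span_image_toggle [IsStrictTotalOrder α r] {a : α}
    (ha : IsLastDependent K r v S a) : span K (v '' Set.toggle a S) = span K (v '' S) := by
  refine _root_.span_image_toggle (span_mono (Set.image_mono ?_) ha.1)
  rintro s ⟨hs, has⟩
  refine ⟨hs, ?_⟩
  rintro rfl
  exact irrefl_of r s has

end VectorNBC

/-! ### Whitney's broken circuit theorem -/

section Whitney

open Module Submodule
open scoped Classical

variable {K M α : Type*} [Field K] [AddCommGroup M] [Module K M] [Fintype α]

/-- Whitney's broken circuit theorem.  The sets that are not NBC cancel in pairs: toggling the last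
index that depends on later members changes neither that index nor the span. -/
theorem sum_neg_one_pow_ncard_eq (r : α → α → Prop) [IsStrictTotalOrder α r] (v : α → M) (m : ℕ) :
    ∑ S : Set α with finrank K (span K (v '' S)) = m, (-1 : ℤ) ^ S.ncard =
      (-1) ^ m * {S : Set α | VectorNBC K r v S ∧ S.encard = m}.ncard := by
  rw [← Finset.sum_filter_add_sum_filter_not _ (fun S => VectorNBC K r v S)]
  have h₂ : ∑ S ∈ ({S : Set α | finrank K (span K (v '' S)) = m} : Finset (Set α)) with
      ¬ VectorNBC K r v S, (-1 : ℤ) ^ S.ncard = 0 := by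
    have hex : ∀ S ∈ ({S ∈ ({S : Set α | finrank K (span K (v '' S)) = m} : Finset (Set α)) |
        ¬ VectorNBC K r v S} : Finset (Set α)), ∃ a, IsLastDependent K r v S a :=
      fun S hS => exists_isLastDependent (Finset.mem_filter.1 hS).2
    choose f hf using hex
    refine Finset.sum_involution (fun S hS => Set.toggle (f S hS) S)
      (fun S _ => neg_one_pow_ncard_toggle _ S) (fun S hS _ h => ?_) (fun S hS => ?_)
      (fun S hS => ?_)
    · have := Set.mem_toggle_self (S := S) (a := f S hS)
      rw [h] at this
      tauto
    · have ha := hf S hS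
      simp only [Finset.mem_filter, Finset.mem_univ, true_and] at hS ⊢
      exact ⟨by rw [ha.span_image_toggle]; exact hS.1, ha.toggle.not_vectorNBC⟩
    · have ha := hf S hS
      have hS' : Set.toggle (f S hS) S ∈
          ({S ∈ ({S : Set α | finrank K (span K (v '' S)) = m} : Finset (Set α)) |
            ¬ VectorNBC K r v S} : Finset (Set α)) := by
        simp only [Finset.mem_filter, Finset.mem_univ, true_and] at hS ⊢
        exact ⟨by rw [ha.span_image_toggle]; exact hS.1, ha.toggle.not_vectorNBC⟩
      have := ha.toggle.unique (hf _ hS')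
      simp only [← this, Set.toggle_toggle]
  rw [h₂, add_zero]
  have h₁ : ({S ∈ ({S : Set α | finrank K (span K (v '' S)) = m} : Finset (Set α)) |
      VectorNBC K r v S} : Finset (Set α)) =
      ({S : Set α | VectorNBC K r v S ∧ S.encard = m} : Finset (Set α)) := by
    ext S
    simp only [Finset.mem_filter, Finset.mem_univ, true_and]
    rw [and_comm]
    refine and_congr_right fun h => ?_
    rw [h.linearIndepOn.finrank_span_eq_ncard, ← S.toFinite.cast_ncard_eq]
    norm_cast
  rw [h₁, Finset.sum_congr rfl (g := fun _ => (-1 : ℤ) ^ m)]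
  · rw [Finset.sum_const, nsmul_eq_mul, mul_comm, Set.ncard_eq_toFinset_card']
    simp
  · intro S hS
    simp only [Finset.mem_filter, Finset.mem_univ, true_and] at hS
    have := hS.2
    rw [← S.toFinite.cast_ncard_eq] at this
    norm_cast at this
    rw [this]

end Whitney

/-! ### Independence of the order, and partitions into blocks -/

section Partition

open Module Submodule

variable {K M α : Type*} [Field K] [AddCommGroup M] [Module K M]

/-- The number of NBC sets of each size does not depend on the order. -/
theorem ncard_vectorNBC_eq [Finite α] (r r' : α → α → Prop) [IsStrictTotalOrder α r]
    [IsStrictTotalOrder α r'] (v : α → M) (m : ℕ) :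
    {S : Set α | VectorNBC K r v S ∧ S.encard = m}.ncard =
      {S : Set α | VectorNBC K r' v S ∧ S.encard = m}.ncard := by
  have := Fintype.ofFinite α
  have h := (sum_neg_one_pow_ncard_eq (K := K) r v m).symm.trans (sum_neg_one_pow_ncard_eq r' v m)
  exact_mod_cast mul_left_cancel₀ (pow_ne_zero m (by norm_num : (-1 : ℤ) ≠ 0)) h

variable {ι : Type*} [LinearOrder ι] {r : α → α → Prop} {v : α → M} {top : α → ι}

/-- If no `v b` is a combination of vectors from earlier blocks, then an independent set of vectors
stays independent when vectors from distinct later blocks are added to it. -/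
theorem LinearIndepOn.union_of_injOn [Finite α]
    (hlow : ∀ (b : α) (T : Set α), (∀ t ∈ T, top t < top b) → v b ∉ span K (v '' T))
    {U T : Set α} (hU : LinearIndepOn K v U) (hT : Set.InjOn top T)
    (hUT : ∀ u ∈ U, ∀ t ∈ T, top u < top t) : LinearIndepOn K v (U ∪ T) := by
  classical
  lift T to Finset α using T.toFinite
  induction T using Finset.induction_on_max_value top with
  | empty => simpa using hU
  | insert a s has hmax ih =>
    rw [Finset.coe_insert, Set.union_insert]
    have hs : (s : Set α) ⊆ ↑(insert a s) := by simp
    refine (ih (hT.mono hs) fun u hu t ht => hUT u hu t (hs ht)).insert (hlow a _ ?_)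
    rintro t (ht | ht)
    · exact hUT t ht a (by simp)
    · refine lt_of_le_of_ne (hmax t ht) fun h => has ?_
      rwa [← hT (hs ht) (by simp) h]

/-- A set with at most one vector from each block is NBC for an order listing the blocks in turn. -/
theorem vectorNBC_of_injOn [Finite α] [IsStrictTotalOrder α r] (hr : ∀ a b, r a b → top a ≤ top b)
    (hlow : ∀ (b : α) (T : Set α), (∀ t ∈ T, top t < top b) → v b ∉ span K (v '' T))
    (hpar : ∀ a b, v a ∈ span K {v b} → a = b) {S : Set α} (hS : Set.InjOn top S) :
    VectorNBC K r v S := by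
  intro a ha
  set T : Set α := {s ∈ S | r a s}
  have haT : a ∉ T := fun h => irrefl_of r a h.2
  have hT : Set.InjOn top T := hS.mono fun s hs => hs.1
  have hU : LinearIndepOn K v (insert a {t ∈ T | top t = top a}) := by
    have ha0 : v a ≠ 0 := fun h => hlow a ∅ (by simp) (by simp [h])
    have hsub : {t ∈ T | top t = top a}.Subsingleton :=
      fun s hs t ht => hT hs.1 ht.1 (hs.2.trans ht.2.symm)
    rcases hsub.eq_empty_or_singleton with h | ⟨b, h⟩
    · rw [h, insert_empty_eq]
      exact LinearIndepOn.singleton ha0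
    · rw [h]
      have hb0 : v b ≠ 0 := fun h => hlow b ∅ (by simp) (by simp [h])
      refine (LinearIndepOn.singleton hb0).insert fun hab => haT ?_
      rw [Set.image_singleton] at hab
      have hb : b ∈ {t ∈ T | top t = top a} := by simp [h]
      exact hpar a b hab ▸ hb.1
  have key : LinearIndepOn K v (insert a T) := by
    have := hU.union_of_injOn (T := {t ∈ T | top a < top t}) hlow
      (hT.mono fun s hs => hs.1) (by
        rintro u (rfl | hu) t ht
        · exact ht.2
        · exact hu.2 ▸ ht.2)
    refine this.mono ?_
    rintro t (rfl | ht)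
    · simp
    · rcases (hr a t ht.2).eq_or_lt with h | h
      · exact Or.inl (Or.inr ⟨ht, h.symm⟩)
      · exact Or.inr ⟨ht, h⟩
  exact ((linearIndepOn_insert haT).1 key).2 ha

/-- If the plane of any two vectors of a block contains a vector of an earlier block, then no NBC set
has two members in a block: the earlier vector is a combination of the two. -/
theorem injOn_of_vectorNBC_of_exists (hr : ∀ a b, top a < top b → r a b)
    (hplane : ∀ b c, b ≠ c → top b = top c → ∃ a, top a < top b ∧ v a ∈ span K {v b, v c})
    {S : Set α} (hS : VectorNBC K r v S) : Set.InjOn top S := by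
  intro b hb c hc h
  by_contra hbc
  obtain ⟨a, hab, ha⟩ := hplane b c hbc h
  refine hS a (span_mono ?_ ha)
  rw [← Set.image_pair]
  refine Set.image_mono ?_
  rintro s (rfl | rfl)
  · exact ⟨hb, hr _ _ hab⟩
  · exact ⟨hc, hr _ _ (h ▸ hab)⟩

/-- If no NBC pair lies within a block, then the plane of any two vectors of a block contains a vector
of an earlier block. -/
theorem exists_mem_span_pair_of_injOn [Finite α] [IsStrictTotalOrder α r]
    (hr : ∀ a b, r a b → top a ≤ top b) (hv : ∀ a, v a ≠ 0) (hpar : ∀ a b, v a ∈ span K {v b} → a = b)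
    (hinj : ∀ S : Set α, VectorNBC K r v S → S.encard = 2 → Set.InjOn top S)
    {b c : α} (hbc : b ≠ c) (htop : top b = top c) :
    ∃ a, top a < top b ∧ v a ∈ span K {v b, v c} := by
  -- The first vector in the plane of `v b` and `v c` forms an NBC pair with any other one.
  obtain ⟨a, ha, hmin⟩ := Set.Finite.exists_first r
    (Set.toFinite {a | v a ∈ span K {v b, v c}}) ⟨b, subset_span (by simp)⟩
  simp only [Set.mem_ofPred_eq] at ha hmin
  refine ⟨a, ?_, ha⟩
  have hab : top a ≤ top b := by
    by_cases h : b = a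
    · rw [h]
    · exact hr _ _ (hmin b (subset_span (by simp)) h)
  refine lt_of_le_of_ne hab fun h => ?_
  obtain ⟨d, hda, hd, hdtop⟩ : ∃ d, d ≠ a ∧ v d ∈ span K {v b, v c} ∧ top d = top b := by
    by_cases h : b = a
    · exact ⟨c, fun hca => hbc (h.trans hca.symm), subset_span (by simp), htop.symm⟩
    · exact ⟨b, h, subset_span (by simp), rfl⟩
  refine hda (hinj {a, d} ?_ (Set.encard_pair (Ne.symm hda)) (by simp) (by simp)
    (h.trans hdtop.symm)).symm
  intro e he
  have hepl : v e ∈ span K {v b, v c} := by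
    refine span_le.2 ?_ he
    rintro _ ⟨s, ⟨rfl | rfl, -⟩, rfl⟩
    · exact ha
    · exact hd
  have hea : ¬ r e a := by
    intro hea
    have hne : e ≠ a := by
      rintro rfl
      exact irrefl_of r e hea
    exact irrefl_of r a (trans_of r (hmin e hepl hne) hea)
  have hsub : {s ∈ ({a, d} : Set α) | r e s} ⊆ {d} := by
    rintro s ⟨rfl | rfl, hs⟩
    · exact (hea hs).elim
    · rfl
  have hed : e = d := by
    refine hpar e d (span_mono ?_ he)
    rw [← Set.image_singleton]
    exact Set.image_mono hsub
  subst hed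
  have hempty : {s ∈ ({a, e} : Set α) | r e s} = ∅ := by
    refine Set.eq_empty_iff_forall_notMem.2 fun s hs => ?_
    have := hsub hs
    rw [Set.mem_singleton_iff] at this
    subst this
    exact irrefl_of r s hs.2
  rw [hempty] at he
  exact hv e (by simpa using he)

/-- The blocks in turn, each block being ordered by `r`. -/
def blockOrder (top : α → ι) (r : α → α → Prop) (a b : α) : Prop :=
  top a < top b ∨ top a = top b ∧ r a b

theorem isStrictTotalOrder_blockOrder [IsStrictTotalOrder α r] :
    IsStrictTotalOrder α (blockOrder top r) where
  trichotomous a b h₁ h₂ := by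
    simp only [blockOrder, not_or, not_and, not_lt] at h₁ h₂
    have h := le_antisymm h₂.1 h₁.1
    rcases trichotomous_of r a b with h' | h' | h'
    · exact (h₁.2 h h').elim
    · exact h'
    · exact (h₂.2 h.symm h').elim
  irrefl a h := by
    rcases h with h | h
    · exact lt_irrefl _ h
    · exact irrefl_of r a h.2
  trans a b c h₁ h₂ := by
    rcases h₁ with h₁ | ⟨h₁, h₁'⟩ <;> rcases h₂ with h₂ | ⟨h₂, h₂'⟩
    · exact Or.inl (h₁.trans h₂)
    · exact Or.inl (h₂ ▸ h₁)
    · exact Or.inl (h₁ ▸ h₂)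
    · exact Or.inr ⟨h₁.trans h₂, trans_of r h₁' h₂'⟩

/-- Sets meeting each block at most once are at most as numerous as the NBC sets of the same size, for
any order, since this holds for the block order and the number of NBC sets does not depend on the
order.  Equality amounts to every NBC set of the block order meeting each block at most once, which
can be tested on pairs. -/
theorem ncard_injOn_le_and_eq_iff [Finite α] (r : α → α → Prop) [IsStrictTotalOrder α r]
    (hlow : ∀ (b : α) (T : Set α), (∀ t ∈ T, top t < top b) → v b ∉ span K (v '' T))
    (hpar : ∀ a b, v a ∈ span K {v b} → a = b) :
    (∀ m : ℕ, {S : Set α | Set.InjOn top S ∧ S.encard = m}.ncard ≤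
      {S : Set α | VectorNBC K r v S ∧ S.encard = m}.ncard) ∧
    ((∀ m : ℕ, {S : Set α | Set.InjOn top S ∧ S.encard = m}.ncard =
      {S : Set α | VectorNBC K r v S ∧ S.encard = m}.ncard) ↔
      ∀ b c, b ≠ c → top b = top c → ∃ a, top a < top b ∧ v a ∈ span K {v b, v c}) := by
  have := isStrictTotalOrder_blockOrder (r := r) (top := top)
  simp only [fun m => ncard_vectorNBC_eq (K := K) r (blockOrder top r) v m]
  have hle : ∀ a b, blockOrder top r a b → top a ≤ top b := by
    rintro a b (h | h)
    · exact h.le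
    · exact h.1.le
  have hsub : ∀ m : ℕ, {S : Set α | Set.InjOn top S ∧ S.encard = m} ⊆
      {S : Set α | VectorNBC K (blockOrder top r) v S ∧ S.encard = m} :=
    fun m S hS => ⟨vectorNBC_of_injOn hle hlow hpar hS.1, hS.2⟩
  refine ⟨fun m => Set.ncard_le_ncard (hsub m) (Set.toFinite _), fun h b c hbc htop => ?_,
    fun h m => ?_⟩
  · refine exists_mem_span_pair_of_injOn hle (fun a ha => hlow a ∅ (by simp) (by simp [ha])) hpar
      (fun S hS hS2 => ?_) hbc htop
    have heq := Set.eq_of_subset_of_ncard_le (hsub 2) (h 2).ge (Set.toFinite _)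
    have hmem : S ∈ {S : Set α | VectorNBC K (blockOrder top r) v S ∧ S.encard = (2 : ℕ)} :=
      ⟨hS, by simpa using hS2⟩
    rw [← heq] at hmem
    exact hmem.1
  · congr 1
    refine (hsub m).antisymm fun S hS => ⟨?_, hS.2⟩
    exact injOn_of_vectorNBC_of_exists (r := blockOrder top r) (fun a b hab => Or.inl hab) h hS.1

end Partition

/-! ### Rank and atoms of the intersection lattice -/

namespace IntersectionLattice

open Module Submodule

variable {K W : Type*} [Field K] [AddCommGroup W] [Module K W] {A : Set (Submodule K W)}

theorem coe_biSup {ι : Type*} (S : Set ι) (f : ι → IntersectionLattice A) :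
    (⨆ a ∈ S, f a).1 = ⨅ a ∈ S, (f a).1 := by
  have h : Subtype.val '' (f '' S) = (fun a => (f a).1) '' S := Set.image_image _ _ _
  rw [← sSup_image, ← sInf_image, ← h]
  rfl

/-- A hyperplane of the arrangement, as an element of the intersection lattice. -/
def ofMem {H : Submodule K W} (hH : H ∈ A) : IntersectionLattice A :=
  ⟨H, {H}, by simpa using hH, by simp⟩

theorem isAtom_iff_mem (hA : ∀ H ∈ A, IsCoatom H) (X : IntersectionLattice A) :
    IsAtom X ↔ X.1 ∈ A := by
  have hbot : (⊥ : IntersectionLattice A).1 = ⊤ := by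
    have h : (sSup ∅ : IntersectionLattice A).1 = sInf (Subtype.val '' ∅) := rfl
    rwa [sSup_empty, Set.image_empty, sInf_empty] at h
  constructor
  · intro hX
    obtain ⟨B, hB, hXB⟩ := X.2
    rcases B.eq_empty_or_nonempty with rfl | ⟨H, hH⟩
    · refine (hX.1 (Subtype.ext ?_)).elim
      rw [hXB, sInf_empty]
      exact hbot.symm
    · have hle : ofMem (hB hH) ≤ X := by
        change X.1 ≤ H
        rw [hXB]
        exact sInf_le hH
      rcases hX.le_iff.1 hle with h | h
      · refine ((hA H (hB hH)).1 ?_).elim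
        rw [← hbot, ← h]
        rfl
      · rw [← h]
        exact hB hH
  · intro hX
    refine ⟨fun h => (hA _ hX).1 (h ▸ hbot), fun Y hY => Subtype.ext ?_⟩
    rw [hbot]
    exact (hA _ hX).2 _ hY

variable [FiniteDimensional K W]

/-- The rank of an element of the intersection lattice is its codimension, here written as the
dimension of the space of linear forms that vanish on it. -/
theorem height_eq_finrank (hfin : A.Finite)
    (hA : ∀ H ∈ A, ∃ f : Dual K W, H = LinearMap.ker f) (X : IntersectionLattice A) :
    Order.height X = finrank K X.1.dualAnnihilator := by
  apply le_antisymm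
  · have hmono : StrictMono fun X : IntersectionLattice A => finrank K X.1.dualAnnihilator := by
      intro X Y hXY
      refine finrank_lt_finrank_of_lt (lt_of_le_of_ne ?_ fun h => hXY.ne ?_)
      · exact dualAnnihilator_anti hXY.le
      · exact Subtype.ext (Subspace.dualAnnihilator_inj.1 h)
    exact (Order.height_le_height_apply_of_strictMono _ hmono X).trans_eq (Order.height_nat _)
  · obtain ⟨B, hB, hXB⟩ := X.2
    lift B to Finset (Submodule K W) using hfin.subset hB
    classical
    induction B using Finset.induction_on generalizing X with
    | empty =>
      have h : finrank K X.1.dualAnnihilator = 0 := by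
        rw [hXB, Finset.coe_empty, sInf_empty, dualAnnihilator_top, finrank_bot]
      rw [h]
      exact zero_le
    | insert H B hHB ih =>
      have hBA : (B : Set (Submodule K W)) ⊆ A := by
        rw [Finset.coe_insert] at hB
        exact (Set.subset_insert _ _).trans hB
      have hXB' : X.1 = H ⊓ sInf (B : Set (Submodule K W)) := by
        rw [hXB, Finset.coe_insert, sInf_insert]
      let Y : IntersectionLattice A := ⟨sInf B, B, hBA, rfl⟩
      have hY := ih Y hBA rfl
      have hYX : Y ≤ X := by
        change X.1 ≤ sInf (B : Set (Submodule K W))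
        rw [hXB']
        exact inf_le_right
      rcases hYX.eq_or_lt with h | h
      · rwa [h] at hY
      · refine le_trans ?_ (Order.height_add_one_le h)
        refine le_trans ?_ (add_le_add_left hY 1)
        obtain ⟨f, rfl⟩ := hA H (hB (by simp))
        have h₁ : (LinearMap.ker f).dualAnnihilator = span K {f} := by
          rw [← Subspace.dualCoannihilator_dualAnnihilator_eq (W := span K {f})]
          congr 1
          ext x
          simp only [LinearMap.mem_ker, mem_dualCoannihilator, mem_span_singleton]
          refine ⟨?_, fun h => h f ⟨1, one_smul K f⟩⟩
          rintro h _ ⟨c, rfl⟩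
          simp [h]
        rw [hXB', Subspace.dualAnnihilator_inf_eq, h₁, sup_comm]
        have h₂ := finrank_add_le_finrank_add_finrank Y.1.dualAnnihilator (span K {f})
        have h₃ : finrank K (span K {f}) ≤ 1 := by
          simpa using finrank_span_le_card ({f} : Set (Dual K W))
        exact_mod_cast h₂.trans (by gcongr)

/-- Independence of atoms in the intersection lattice is linear independence of linear forms that
define the atoms. -/
theorem atomIndependent_iff (hfin : A.Finite)
    {v : LatticeAtom (IntersectionLattice A) → Dual K W}
    (hA : ∀ H ∈ A, ∃ f : Dual K W, H = LinearMap.ker f) (hv : ∀ a, a.1.1 = LinearMap.ker (v a))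
    [Finite (LatticeAtom (IntersectionLattice A))]
    (S : Set (LatticeAtom (IntersectionLattice A))) :
    AtomIndependent S ↔ LinearIndepOn K v S := by
  have h : (⨆ a ∈ S, a.1).1 = (span K (v '' S)).dualCoannihilator := by
    rw [coe_biSup]
    ext x
    simp only [hv, mem_iInf, LinearMap.mem_ker, mem_dualCoannihilator]
    refine ⟨fun h φ hφ => ?_, fun h a ha => h _ (subset_span ⟨a, ha, rfl⟩)⟩
    have hle : span K (v '' S) ≤ LinearMap.ker (Dual.eval K W x) := by
      rw [span_le]
      rintro _ ⟨a, ha, rfl⟩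
      exact h a ha
    exact hle hφ
  rw [AtomIndependent, height_eq_finrank hfin hA, h, Subspace.dualCoannihilator_dualAnnihilator_eq,
    linearIndepOn_iff_finrank_span_eq_ncard, ← S.toFinite.cast_ncard_eq]
  norm_cast

theorem isNBC_iff_vectorNBC (prec : LatticeAtom (IntersectionLattice A) →
      LatticeAtom (IntersectionLattice A) → Prop)
    [IsStrictTotalOrder (LatticeAtom (IntersectionLattice A)) prec] (hfin : A.Finite)
    {v : LatticeAtom (IntersectionLattice A) → Dual K W}
    (hA : ∀ H ∈ A, ∃ f : Dual K W, H = LinearMap.ker f) (hv : ∀ a, a.1.1 = LinearMap.ker (v a))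
    [Finite (LatticeAtom (IntersectionLattice A))]
    (S : Set (LatticeAtom (IntersectionLattice A))) :
    IsNBC prec S ↔ VectorNBC K prec v S := by
  have hC : ∀ C : Set (LatticeAtom (IntersectionLattice A)),
      AtomCircuit C ↔ Minimal (fun S => ¬ LinearIndepOn K v S) C := by
    intro C
    simp only [AtomCircuit, atomIndependent_iff hfin hA hv]
  constructor
  · intro h a ha
    set T := {s ∈ S | prec a s} with hT
    have haT : a ∉ T := fun h => irrefl_of prec a h.2
    have hdep : ¬ LinearIndepOn K v (insert a T) := fun h => ((linearIndepOn_insert haT).1 h).2 ha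
    obtain ⟨C, hCT, hCmin, b, hb, hbmin⟩ := exists_minimal_not_linearIndepOn_first prec hdep
    refine h (C \ {b}) ?_ ⟨C, (hC C).2 hCmin, b, hb, hbmin, rfl⟩
    rintro s ⟨hs, hsb⟩
    rcases hCT hs with rfl | hsT
    · -- The first element of the circuit would come before `a`, but `a` comes before all of `T`.
      have h₁ := hbmin s hs hsb
      rcases hCT hb with rfl | hbT
      · exact (hsb rfl).elim
      · exact (irrefl_of prec b (trans_of prec h₁ hbT.2)).elim
    · exact hsT.1
  · rintro h T hTS ⟨C, hCmin, a, ha, hmin, rfl⟩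
    have hsub : C \ {a} ⊆ {s ∈ S | prec a s} := fun b hb => ⟨hTS hb, hmin b hb.1 hb.2⟩
    exact h a (span_mono (Set.image_mono hsub)
      (mem_span_of_minimal_not_linearIndepOn ((hC C).1 hCmin) ha))

end IntersectionLattice

/-! ### Increasing forests and lower edges -/

namespace Graph

variable {V E : Type*} [LinearOrder V] {H : Graph V E}

/-- Every vertex is the larger end of at most one edge. -/
def AtMostOneLowerEdge (H : Graph V E) : Prop :=
  ∀ e f x x' y, x < y → x' < y → H.IsLink e x y → H.IsLink f x' y → e = f

theorem AtMostOneLowerEdge.isForest (h : H.AtMostOneLowerEdge)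
    (hloop : ∀ e x, ¬ H.IsLink e x x) : H.IsForest := by
  rintro ⟨k, v, e, hk, hlink, hclosed, hv, he⟩
  -- The two edges of the cycle at its largest vertex go down.
  obtain ⟨i, hi, hmax⟩ := Finset.exists_max_image (Finset.range k) v ⟨0, Finset.mem_range.2 hk⟩
  simp only [Finset.mem_range] at hi hmax
  have hmax' : ∀ j ≤ k, v j ≤ v i := by
    intro j hj
    rcases hj.eq_or_lt with rfl | hj
    · rw [hclosed]
      exact hmax 0 hk
    · exact hmax j hj
  have hlt : ∀ e j, j ≤ k → H.IsLink e (v j) (v i) → v j < v i := fun e j hj hl =>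
    lt_of_le_of_ne (hmax' j hj) fun h => hloop e (v i) (by rwa [h] at hl)
  -- The edge `e j` precedes the vertex `v i` on the cycle; if `i = 0` it is the last edge.
  obtain ⟨j, hj, hji⟩ : ∃ j < k, v (j + 1) = v i := by
    rcases Nat.eq_zero_or_pos i with rfl | hi0
    · exact ⟨k - 1, by omega, by rw [Nat.sub_add_cancel hk, hclosed]⟩
    · exact ⟨i - 1, by omega, by rw [Nat.sub_add_cancel hi0]⟩
  have h₁ := (hlink i hi).symm
  have h₂ := hlink j hj
  rw [hji] at h₂
  have hee := h _ _ _ _ _ (hlt _ _ (by omega) h₁) (hlt _ _ hj.le h₂) h₁ h₂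
  have hij := he (Set.mem_Iio.2 hi) (Set.mem_Iio.2 hj) hee
  subst hij
  exact hloop _ _ (hji ▸ hlink i hi)

theorem AtMostOneLowerEdge.isChain_lt (h : H.AtMostOneLowerEdge) :
    ∀ (l : List V) (x y : V), x < y → (x :: y :: l).IsChain H.Adj → (x :: y :: l).Nodup →
      (x :: y :: l).IsChain (· < ·) := by
  intro l
  induction l with
  | nil => intro x y hxy _ _; simpa using hxy
  | cons z l ih =>
    intro x y hxy hc hn
    have hyz : y < z := by
      rw [List.isChain_cons_cons, List.isChain_cons_cons] at hc
      obtain ⟨⟨e, he⟩, ⟨f, hf⟩, -⟩ := hc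
      rcases lt_trichotomy y z with hlt | rfl | hlt
      · exact hlt
      · simp at hn
      · have := h e f x z y hxy hlt he hf.symm
        subst this
        have hxz := he.left_unique hf.symm
        simp [hxz] at hn
    rw [List.isChain_cons_cons]
    exact ⟨hxy, ih y z hyz hc.tail hn.tail⟩

theorem AtMostOneLowerEdge.isIncreasingForest (h : H.AtMostOneLowerEdge)
    (hloop : ∀ e x, ¬ H.IsLink e x x) : H.IsIncreasingForest := by
  refine ⟨h.isForest hloop, fun r l hr hc hn => ?_⟩
  cases l with
  | nil => simp
  | cons y l =>
    have hadj : H.Adj r y := (List.isChain_cons_cons.1 hc).1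
    refine h.isChain_lt l r y (lt_of_le_of_ne (hr.2 y (.single hadj)) ?_) hc hn
    rintro rfl
    simp at hn

/-- A path from `x` to `y`, as the list of its vertices. -/
theorem exists_path_of_reflTransGen {x y : V} (h : Relation.ReflTransGen H.Adj x y) :
    ∃ l : List V, (x :: l).IsChain H.Adj ∧ (x :: l).Nodup ∧ (x :: l).getLast? = some y := by
  induction h with
  | refl => exact ⟨[], by simp⟩
  | @tail y z _ hyz ih =>
    obtain ⟨l, hc, hn, hl⟩ := ih
    by_cases hz : z ∈ x :: l
    · obtain ⟨s, t, hst⟩ := List.append_of_mem hz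
      cases s with
      | nil =>
        simp only [List.nil_append, List.cons.injEq] at hst
        exact ⟨[], by simp [hst.1]⟩
      | cons w s =>
        simp only [List.cons_append, List.cons.injEq] at hst
        obtain ⟨rfl, rfl⟩ := hst
        have hpre : (x :: (s ++ [z])) <+: (x :: (s ++ z :: t)) := ⟨t, by simp⟩
        exact ⟨s ++ [z], hc.prefix hpre, hn.sublist hpre.sublist,
          List.getLast?_eq_some_iff.2 ⟨x :: s, rfl⟩⟩
    · refine ⟨l ++ [z], ?_, ?_, List.getLast?_eq_some_iff.2 ⟨x :: l, rfl⟩⟩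
      · rw [← List.cons_append, List.isChain_append]
        refine ⟨hc, by simp, fun a ha b hb => ?_⟩
        rw [hl, Option.mem_some_iff] at ha
        rw [List.head?_cons, Option.mem_some_iff] at hb
        rwa [← ha, ← hb]
      · rw [← List.cons_append, List.nodup_append]
        exact ⟨hn, by simp, fun a ha b hb => by
          rintro rfl
          simp only [List.mem_singleton] at hb
          exact hz (hb ▸ ha)⟩

theorem exists_isRoot_reflTransGen [Finite V] {x : V} (hx : x ∈ H.vertexSet) :
    ∃ r, H.IsRoot r ∧ Relation.ReflTransGen H.Adj r x := by
  have : Std.Symm H.Adj := ⟨fun a b h => h.symm⟩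
  obtain ⟨r, hr, hmin⟩ := Set.exists_min_image {y | Relation.ReflTransGen H.Adj y x} id
    (Set.toFinite _) ⟨x, .refl⟩
  refine ⟨r, ⟨?_, fun w hw => hmin w (Relation.ReflTransGen.trans ?_ hr)⟩, hr⟩
  · rcases hr.cases_head with rfl | ⟨w, ⟨e, he⟩, -⟩
    · exact hx
    · exact he.left_mem
  · exact symm_of _ hw

/-- If `x` and `x'` are both smaller neighbours of `y`, then `x'` lies on the increasing path from
the root to `x`, for otherwise this path could be continued by `y` and `x'`. -/
theorem IsIncreasingForest.lt_of_adj [Finite V] (h : H.IsIncreasingForest) {r x x' y : V}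
    (hr : H.IsRoot r) (hrx : Relation.ReflTransGen H.Adj r x) (hxy : x < y) (hx'y : x' < y)
    (hadj : H.Adj x y) (hadj' : H.Adj x' y) (hne : x' ≠ x) : x' < x := by
  obtain ⟨l, hc, hn, hl⟩ := exists_path_of_reflTransGen hrx
  have hinc := h.2 r l hr hc hn
  have hle : ∀ z ∈ r :: l, z ≤ x := by
    intro z hz
    obtain ⟨s, hs⟩ := List.getLast?_eq_some_iff.1 hl
    have hp := hinc.pairwise
    rw [hs] at hp hz
    rcases List.mem_append.1 hz with hz | hz
    · exact ((List.pairwise_append.1 hp).2.2 z hz x (by simp)).le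
    · exact (List.mem_singleton.1 hz).le
  by_contra hx'x
  have hx'l : x' ∉ r :: l := fun hmem => hx'x (lt_of_le_of_ne (hle x' hmem) hne)
  have hyl : y ∉ r :: l := fun hmem => absurd (hle y hmem) (not_le.2 hxy)
  have hc' : (r :: (l ++ [y, x'])).IsChain H.Adj := by
    rw [← List.cons_append, List.isChain_append]
    refine ⟨hc, by simpa using hadj'.symm, fun a ha b hb => ?_⟩
    rw [hl, Option.mem_some_iff] at ha
    rw [List.head?_cons, Option.mem_some_iff] at hb
    rwa [← ha, ← hb]
  have hn' : (r :: (l ++ [y, x'])).Nodup := by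
    rw [← List.cons_append, List.nodup_append]
    refine ⟨hn, by simpa using hx'y.ne', fun a ha b hb => ?_⟩
    rintro rfl
    simp only [List.mem_cons, List.not_mem_nil, or_false] at hb
    rcases hb with rfl | rfl
    · exact hyl ha
    · exact hx'l ha
  have := h.2 r _ hr hc' hn'
  rw [← List.cons_append, List.isChain_append] at this
  have h₂ := this.2.1
  simp only [List.isChain_cons_cons] at h₂
  exact lt_asymm hx'y h₂.1

theorem IsIncreasingForest.atMostOneLowerEdge [Finite V] (h : H.IsIncreasingForest) :
    H.AtMostOneLowerEdge := by
  intro e f x x' y hxy hx'y he hf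
  by_contra hef
  obtain ⟨r, hr, hrx⟩ := H.exists_isRoot_reflTransGen he.left_mem
  rcases eq_or_ne x' x with rfl | hne
  · -- Two parallel edges form a cycle.
    refine h.1 ⟨2, fun i => if i = 1 then y else x', fun i => if i = 0 then e else f, by norm_num,
      fun i hi => ?_, by simp, fun i hi j hj hij => ?_, fun i hi j hj hij => ?_⟩
    · interval_cases i
      · simpa using he
      · simpa using hf.symm
    · simp only [Set.mem_Iio] at hi hj
      have := hxy.ne
      interval_cases i <;> interval_cases j <;> simp_all
    · simp only [Set.mem_Iio] at hi hj
      interval_cases i <;> interval_cases j <;> simp_all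
  · have hrx' : Relation.ReflTransGen H.Adj r x' :=
      (hrx.tail ⟨e, he⟩).tail ⟨f, hf.symm⟩
    exact lt_asymm (h.lt_of_adj hr hrx hxy hx'y ⟨e, he⟩ ⟨f, hf⟩ hne)
      (h.lt_of_adj hr hrx' hx'y hxy ⟨f, hf⟩ ⟨e, he⟩ hne.symm)

end Graph

/-! ### Linear forms of the edges -/

namespace LabeledMultigraph

open Module Submodule

variable {n : ℕ} {E : Type*}

/-- The coordinate form `x_i`, where `x_0 = 0`. -/
def coordForm (i : Fin (n + 1)) : Dual ℂ (Fin n → ℂ) :=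
  Fin.cases 0 (fun k => LinearMap.proj k) i

@[simp]
theorem coordForm_zero : coordForm (0 : Fin (n + 1)) = 0 := rfl

@[simp]
theorem coordForm_succ (k : Fin n) : coordForm k.succ = LinearMap.proj k := rfl

theorem coordForm_apply_single (i : Fin (n + 1)) (k : Fin n) :
    coordForm i (Pi.single k 1) = if i = k.succ then 1 else 0 := by
  cases i using Fin.cases with
  | zero => simp [(Fin.succ_ne_zero k).symm]
  | succ i => simp [Pi.single_apply, Fin.succ_inj]

/-- The linear form `x_i - c x_j`, where `x_0 = 0`. -/
def binomialForm (i j : Fin (n + 1)) (c : ℂ) : Dual ℂ (Fin n → ℂ) :=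
  coordForm i - c • coordForm j

theorem binomialForm_apply_single (i j : Fin (n + 1)) (c : ℂ) (k : Fin n) :
    binomialForm i j c (Pi.single k 1) =
      (if i = k.succ then 1 else 0) - c * if j = k.succ then 1 else 0 := by
  simp [binomialForm, coordForm_apply_single]

theorem binomialForm_ne_zero {i j : Fin (n + 1)} {c : ℂ} (hij : i < j) (hc : c ≠ 0) :
    binomialForm i j c ≠ 0 := by
  intro h
  obtain ⟨k, rfl⟩ := Fin.exists_succ_eq.2 (Fin.ne_zero_of_lt hij)
  have := LinearMap.congr_fun h (Pi.single k 1)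
  rw [binomialForm_apply_single] at this
  simp [hij.ne, hc] at this

/-- The form `x_i - c x_j` determines `i` and `j` up to a scalar factor, and `c` if `i ≠ 0`. -/
theorem eq_of_binomialForm_eq_smul {i j i' j' : Fin (n + 1)} {c c' s : ℂ} (hij : i < j)
    (hij' : i' < j') (hc : c ≠ 0) (hc' : c' ≠ 0)
    (h : binomialForm i j c = s • binomialForm i' j' c') :
    i = i' ∧ j = j' ∧ (i ≠ 0 → c = c') := by
  have hs : s ≠ 0 := by
    rintro rfl
    exact binomialForm_ne_zero hij hc (by simpa using h)
  have key : ∀ m : Fin (n + 1), m ≠ 0 → ((if i = m then 1 else 0) - c * if j = m then 1 else 0) =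
      s * ((if i' = m then 1 else 0) - c' * if j' = m then 1 else 0) := by
    intro m hm
    obtain ⟨k, rfl⟩ := Fin.exists_succ_eq.2 hm
    have := LinearMap.congr_fun h (Pi.single k 1)
    rwa [LinearMap.smul_apply, binomialForm_apply_single, binomialForm_apply_single,
      smul_eq_mul] at this
  have hj : j = j' := by
    apply le_antisymm
    · by_contra! hlt
      have := key j (Fin.ne_zero_of_lt hij)
      simp [hij.ne, (hij'.trans hlt).ne, hlt.ne, hc] at this
    · by_contra! hlt
      have := key j' (Fin.ne_zero_of_lt hij')
      simp [hij'.ne, (hij.trans hlt).ne, hlt.ne, hc', hs] at this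
  subst hj
  have hj := key j (Fin.ne_zero_of_lt hij)
  simp only [hij.ne, hij'.ne, if_true, if_false] at hj
  by_cases hi : i = 0
  · refine ⟨?_, rfl, fun h => (h hi).elim⟩
    by_contra hne
    have := key i' fun h => hne (hi.trans h.symm)
    simp only [hne, hij'.ne', if_true, if_false] at this
    exact hs (by linear_combination -this)
  · have hi' := key i hi
    simp only [hij.ne', if_true, if_false] at hi'
    by_cases hii : i' = i
    · simp only [hii, if_true] at hi'
      have hs1 : s = 1 := by linear_combination -hi'
      refine ⟨hii.symm, rfl, fun _ => ?_⟩
      rw [hs1] at hj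
      linear_combination -hj
    · simp [hii] at hi'

variable (G : LabeledMultigraph n E)

theorem exists_isLink_lt (e : G.edgeSet) : ∃ x y, x < y ∧ G.IsLink e x y := by
  obtain ⟨x, y, h⟩ := G.exists_isLink_of_mem_edgeSet e.2
  rcases lt_trichotomy x y with hlt | rfl | hlt
  · exact ⟨x, y, hlt, h⟩
  · exact (G.loopless _ _ h).elim
  · exact ⟨y, x, hlt, h.symm⟩

/-- The smaller end of an edge. -/
def lower (e : G.edgeSet) : Fin (n + 1) := (G.exists_isLink_lt e).choose

/-- The larger end of an edge. -/
def upper (e : G.edgeSet) : Fin (n + 1) := (G.exists_isLink_lt e).choose_spec.choose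

theorem lower_lt_upper (e : G.edgeSet) : G.lower e < G.upper e :=
  (G.exists_isLink_lt e).choose_spec.choose_spec.1

theorem isLink_lower_upper (e : G.edgeSet) : G.IsLink e (G.lower e) (G.upper e) :=
  (G.exists_isLink_lt e).choose_spec.choose_spec.2

variable {G} in
theorem lower_eq_and_upper_eq {e : G.edgeSet} {x y : Fin (n + 1)} (hxy : x < y)
    (h : G.IsLink e x y) : G.lower e = x ∧ G.upper e = y := by
  rcases (G.isLink_lower_upper e).eq_and_eq_or_eq_and_eq h with h | ⟨h₁, h₂⟩
  · exact h
  · have := G.lower_lt_upper e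
    rw [h₁, h₂] at this
    exact (lt_asymm this hxy).elim

/-- The coefficient of an edge: its label, or `-1` for an edge at the vertex `0`, so that the
hyperplane of the edge `ij` with `i < j` is always `x_i = c x_j`, where `x_0 = 0`. -/
def coeff (e : G.edgeSet) : ℂ := if G.lower e = 0 then -1 else G.label e

theorem coeff_ne_zero (e : G.edgeSet) : G.coeff e ≠ 0 := by
  rw [coeff]
  split_ifs with h
  · simp
  · exact G.label_ne_zero e _ _ h (Fin.ne_zero_of_lt (G.lower_lt_upper e)) (G.isLink_lower_upper e)

/-- The linear form that defines the hyperplane of an edge. -/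
def edgeForm (e : G.edgeSet) : Dual ℂ (Fin n → ℂ) :=
  binomialForm (G.lower e) (G.upper e) (G.coeff e)

theorem edgeForm_ne_zero (e : G.edgeSet) : G.edgeForm e ≠ 0 :=
  binomialForm_ne_zero (G.lower_lt_upper e) (G.coeff_ne_zero e)

variable {G}

theorem edge_ext {e f : G.edgeSet} (hl : G.lower e = G.lower f) (hu : G.upper e = G.upper f)
    (hc : G.lower e ≠ 0 → G.coeff e = G.coeff f) : e = f := by
  have he := G.isLink_lower_upper e
  have hf := G.isLink_lower_upper f
  rw [← hl, ← hu] at hf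
  by_cases h : G.lower e = 0
  · rw [h] at he hf
    exact Subtype.ext (G.zero_edge_unique _ _ _ he hf)
  · refine Subtype.ext (G.label_injective _ _ _ _ h
      (Fin.ne_zero_of_lt (G.lower_lt_upper e)) he hf ?_)
    simpa [coeff, ← hl, h] using hc h

theorem eq_of_edgeForm_mem_span_singleton {e f : G.edgeSet}
    (h : G.edgeForm e ∈ span ℂ {G.edgeForm f}) : e = f := by
  obtain ⟨s, hs⟩ := mem_span_singleton.1 h
  obtain ⟨h₁, h₂, h₃⟩ := eq_of_binomialForm_eq_smul (G.lower_lt_upper e) (G.lower_lt_upper f)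
    (G.coeff_ne_zero e) (G.coeff_ne_zero f) hs.symm
  exact edge_ext h₁ h₂ h₃

/-- The form of an edge involves the coordinate of its larger end, unlike the forms of the edges
with smaller larger end. -/
theorem edgeForm_notMem_span {e : G.edgeSet} {T : Set G.edgeSet}
    (hT : ∀ t ∈ T, G.upper t < G.upper e) : G.edgeForm e ∉ span ℂ (G.edgeForm '' T) := by
  intro h
  obtain ⟨k, hk⟩ := Fin.exists_succ_eq.2 (Fin.ne_zero_of_lt (G.lower_lt_upper e))
  have hle : span ℂ (G.edgeForm '' T) ≤
      LinearMap.ker (Dual.eval ℂ (Fin n → ℂ) (Pi.single k 1)) := by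
    rw [span_le]
    rintro _ ⟨t, ht, rfl⟩
    have h₁ := hT t ht
    have h₂ := (G.lower_lt_upper t).trans h₁
    simp [edgeForm, binomialForm_apply_single, hk, h₁.ne, h₂.ne]
  have := hle h
  simp [edgeForm, binomialForm_apply_single, hk, (G.lower_lt_upper e).ne, G.coeff_ne_zero] at this

theorem hasEdge_iff {i j : Fin n} (hij : i < j) {γ : ℂ} : G.HasEdge i j γ ↔
    ∃ e : G.edgeSet, G.lower e = i.succ ∧ G.upper e = j.succ ∧ G.coeff e = γ := by
  constructor
  · rintro ⟨e, he, hγ⟩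
    obtain ⟨h₁, h₂⟩ := lower_eq_and_upper_eq (e := ⟨e, he.edge_mem⟩) (Fin.succ_lt_succ_iff.2 hij) he
    exact ⟨⟨e, he.edge_mem⟩, h₁, h₂, by simpa [coeff, h₁] using hγ⟩
  · rintro ⟨e, h₁, h₂, hγ⟩
    have := G.isLink_lower_upper e
    rw [h₁, h₂] at this
    exact ⟨e, this, by simpa [coeff, h₁] using hγ⟩

theorem hasZeroEdge_iff {k : Fin n} : G.HasZeroEdge k ↔
    ∃ e : G.edgeSet, G.lower e = 0 ∧ G.upper e = k.succ := by
  constructor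
  · rintro ⟨e, he⟩
    exact ⟨⟨e, he.edge_mem⟩,
      lower_eq_and_upper_eq (e := ⟨e, he.edge_mem⟩) (Fin.succ_pos k) he⟩
  · rintro ⟨e, h₁, h₂⟩
    have := G.isLink_lower_upper e
    rw [h₁, h₂] at this
    exact ⟨e, this⟩

/-! ### Perfect labelings -/

/-- For edges `ik` and `jk` with `i < j < k`, the plane of their forms contains exactly one form, up
to scalars, that does not involve `x_k`. -/
theorem mem_span_edgeForm_iff_of_lower_lt {a b c : G.edgeSet} (hl : G.lower b < G.lower c)
    (hu : G.upper b = G.upper c) :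
    (G.upper a < G.upper b ∧ G.edgeForm a ∈ span ℂ {G.edgeForm b, G.edgeForm c}) ↔
      G.lower a = G.lower b ∧ G.upper a = G.lower c ∧
        (G.lower b ≠ 0 → G.coeff a = G.coeff b / G.coeff c) := by
  have hc := G.coeff_ne_zero c
  have hform : G.edgeForm b - (G.coeff b / G.coeff c) • G.edgeForm c =
      binomialForm (G.lower b) (G.lower c) (G.coeff b / G.coeff c) := by
    simp only [edgeForm, binomialForm, hu]
    match_scalars <;> field_simp
    ring
  constructor
  · rintro ⟨hlt, h⟩
    obtain ⟨s, t, hst⟩ := mem_span_pair.1 h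
    obtain ⟨k, hk⟩ := Fin.exists_succ_eq.2 (Fin.ne_zero_of_lt (G.lower_lt_upper b))
    have hk0 := LinearMap.congr_fun hst (Pi.single k 1)
    have hbk := (G.lower_lt_upper b).ne
    have hck := (G.lower_lt_upper c).ne
    have hak := ((G.lower_lt_upper a).trans hlt).ne
    rw [← hu] at hck
    simp [edgeForm, binomialForm_apply_single, hk, ← hu, hlt.ne, hbk, hck, hak] at hk0
    have ht : t = -(s * (G.coeff b / G.coeff c)) := by
      field_simp
      linear_combination -hk0
    have ha : G.edgeForm a = s • binomialForm (G.lower b) (G.lower c) (G.coeff b / G.coeff c) := by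
      rw [← hform, ← hst, ht]
      module
    obtain ⟨h₁, h₂, h₃⟩ := eq_of_binomialForm_eq_smul (G.lower_lt_upper a) hl (G.coeff_ne_zero a)
      (div_ne_zero (G.coeff_ne_zero b) hc) ha
    exact ⟨h₁, h₂, fun h => h₃ (h₁ ▸ h)⟩
  · rintro ⟨h₁, h₂, h₃⟩
    refine ⟨by rw [h₂, hu]; exact G.lower_lt_upper c, ?_⟩
    by_cases hb : G.lower b = 0
    · have ha : G.edgeForm a =
          (-G.coeff a * G.coeff c / G.coeff b * -1) • (G.edgeForm b - (G.coeff b / G.coeff c) •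
            G.edgeForm c) := by
        have hb' := G.coeff_ne_zero b
        rw [hform, edgeForm, h₁, h₂, hb]
        simp only [binomialForm, coordForm_zero]
        match_scalars
        field_simp
      rw [ha]
      exact smul_mem _ _ (sub_mem (subset_span (by simp)) (smul_mem _ _ (subset_span (by simp))))
    · have ha : G.edgeForm a = G.edgeForm b - (G.coeff b / G.coeff c) • G.edgeForm c := by
        rw [hform, edgeForm, h₁, h₂, h₃ hb]
      rw [ha]
      exact sub_mem (subset_span (by simp)) (smul_mem _ _ (subset_span (by simp)))

/-- For two edges `jk`, the plane of their forms contains exactly one form, up to scalars, that does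
not involve `x_k`, namely `x_j`. -/
theorem mem_span_edgeForm_iff_of_lower_eq {a b c : G.edgeSet} (hl : G.lower b = G.lower c)
    (hu : G.upper b = G.upper c) (hbc : b ≠ c) :
    (G.upper a < G.upper b ∧ G.edgeForm a ∈ span ℂ {G.edgeForm b, G.edgeForm c}) ↔
      G.lower a = 0 ∧ G.upper a = G.lower b := by
  have hlc : G.lower b ≠ 0 ∧ G.coeff b ≠ G.coeff c := by
    by_contra h
    rw [not_and_not_right] at h
    exact hbc (edge_ext hl hu h)
  have hne := sub_ne_zero.2 hlc.2
  have hpos := Fin.pos_of_ne_zero hlc.1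
  have hform : (-G.coeff c / (G.coeff b - G.coeff c)) • G.edgeForm b +
      (G.coeff b / (G.coeff b - G.coeff c)) • G.edgeForm c = coordForm (G.lower b) := by
    simp only [edgeForm, binomialForm, ← hu, ← hl]
    match_scalars <;> field_simp <;> ring
  constructor
  · rintro ⟨hlt, h⟩
    obtain ⟨s, t, hst⟩ := mem_span_pair.1 h
    obtain ⟨k, hk⟩ := Fin.exists_succ_eq.2 (Fin.ne_zero_of_lt (G.lower_lt_upper b))
    have hk0 := LinearMap.congr_fun hst (Pi.single k 1)
    have hbk := (G.lower_lt_upper b).ne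
    have hak := ((G.lower_lt_upper a).trans hlt).ne
    simp [edgeForm, binomialForm_apply_single, hk, ← hu, ← hl, hlt.ne, hbk, hak] at hk0
    have ha : G.edgeForm a = (s + t) • binomialForm 0 (G.lower b) (-1) := by
      rw [← hst]
      simp only [edgeForm, binomialForm, ← hu, ← hl, coordForm_zero]
      match_scalars
      · ring
      · linear_combination hk0
    obtain ⟨h₁, h₂, -⟩ := eq_of_binomialForm_eq_smul (G.lower_lt_upper a) hpos (G.coeff_ne_zero a)
      (by norm_num) ha
    exact ⟨h₁, h₂⟩
  · rintro ⟨h₁, h₂⟩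
    refine ⟨h₂ ▸ G.lower_lt_upper b, ?_⟩
    have ha : G.edgeForm a = (-G.coeff a) • coordForm (G.lower b) := by
      simp [edgeForm, binomialForm, h₁, h₂]
    rw [ha, ← hform]
    exact smul_mem _ _ (add_mem (smul_mem _ _ (subset_span (by simp)))
      (smul_mem _ _ (subset_span (by simp))))

/-- Perfect labelings in terms of the linear forms of the edges: the plane of the forms of two edges
with the same larger end contains the form of an edge with smaller larger end. -/
theorem isPerfectlyLabeled_iff : G.IsPerfectlyLabeled ↔
    ∀ b c : G.edgeSet, b ≠ c → G.upper b = G.upper c →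
      ∃ a, G.upper a < G.upper b ∧ G.edgeForm a ∈ span ℂ {G.edgeForm b, G.edgeForm c} := by
  constructor
  · rintro ⟨h₁, h₂, h₃⟩ b c hbc hu
    wlog hl : G.lower b ≤ G.lower c generalizing b c with H
    · obtain ⟨a, ha, ha'⟩ := H c b hbc.symm hu.symm (le_of_not_ge hl)
      exact ⟨a, hu ▸ ha, Set.pair_comm (G.edgeForm b) _ ▸ ha'⟩
    obtain ⟨k, hk⟩ := Fin.exists_succ_eq.2 (Fin.ne_zero_of_lt (G.lower_lt_upper c))
    have hck := G.lower_lt_upper c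
    rcases hl.eq_or_lt with hl | hl
    · simp only [mem_span_edgeForm_iff_of_lower_eq hl hu hbc]
      have hj : G.lower b ≠ 0 := by
        intro h
        exact hbc (edge_ext hl hu fun h' => (h' h).elim)
      obtain ⟨j, hj⟩ := Fin.exists_succ_eq.2 hj
      have hjk : j < k := by
        rwa [← hk, ← hl, ← hj, Fin.succ_lt_succ_iff] at hck
      rw [← hj, ← hasZeroEdge_iff]
      refine h₂ j k (G.coeff b) (G.coeff c) hjk
        ((hasEdge_iff hjk).2 ⟨b, hj.symm, by rw [hu, hk], rfl⟩)
        ((hasEdge_iff hjk).2 ⟨c, by rw [hj, hl], hk.symm, rfl⟩) fun h => hbc ?_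
      exact edge_ext hl hu fun _ => h
    · simp only [mem_span_edgeForm_iff_of_lower_lt hl hu]
      obtain ⟨j, hj⟩ := Fin.exists_succ_eq.2 (Fin.ne_zero_of_lt hl)
      have hjk : j < k := by
        rwa [← hk, ← hj, Fin.succ_lt_succ_iff] at hck
      have hc := (hasEdge_iff hjk).2 ⟨c, hj.symm, hk.symm, rfl⟩
      by_cases hb : G.lower b = 0
      · obtain ⟨a, ha, ha'⟩ := hasZeroEdge_iff.1
          (h₃ j k _ hjk hc (hasZeroEdge_iff.2 ⟨b, hb, by rw [hu, hk]⟩))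
        exact ⟨a, by rw [ha, hb], by rw [ha', hj], fun h => (h hb).elim⟩
      · obtain ⟨i, hi⟩ := Fin.exists_succ_eq.2 hb
        have hij : i < j := by
          rwa [← hi, ← hj, Fin.succ_lt_succ_iff] at hl
        obtain ⟨a, ha, ha', hac⟩ := (hasEdge_iff hij).1 (h₁ i j k _ _ hij hjk
          ((hasEdge_iff (hij.trans hjk)).2 ⟨b, hi.symm, by rw [hu, hk], rfl⟩) hc)
        exact ⟨a, by rw [ha, hi], by rw [ha', hj], fun _ => hac⟩
  · refine fun h => ⟨fun i j k α β hij hjk hα hβ => ?_, fun j k γ ε hjk hγ hε hne => ?_,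
      fun j k γ hjk hγ hk => ?_⟩
    · obtain ⟨b, hb, hb', rfl⟩ := (hasEdge_iff (hij.trans hjk)).1 hα
      obtain ⟨c, hc, hc', rfl⟩ := (hasEdge_iff hjk).1 hβ
      have hl : G.lower b < G.lower c := by rwa [hb, hc, Fin.succ_lt_succ_iff]
      have hu := hb'.trans hc'.symm
      obtain ⟨a, ha⟩ := h b c (fun h => hl.ne (h ▸ rfl)) hu
      obtain ⟨h₁, h₂, h₃⟩ := (mem_span_edgeForm_iff_of_lower_lt hl hu).1 ha
      exact (hasEdge_iff hij).2 ⟨a, h₁.trans hb, h₂.trans hc, h₃ (hb ▸ Fin.succ_ne_zero i)⟩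
    · obtain ⟨b, hb, hb', rfl⟩ := (hasEdge_iff hjk).1 hγ
      obtain ⟨c, hc, hc', rfl⟩ := (hasEdge_iff hjk).1 hε
      have hl := hb.trans hc.symm
      have hu := hb'.trans hc'.symm
      have hbc : b ≠ c := fun h => hne (h ▸ rfl)
      obtain ⟨a, ha⟩ := h b c hbc hu
      obtain ⟨h₁, h₂⟩ := (mem_span_edgeForm_iff_of_lower_eq hl hu hbc).1 ha
      exact hasZeroEdge_iff.2 ⟨a, h₁, h₂.trans hb⟩
    · obtain ⟨b, hb, hb'⟩ := hasZeroEdge_iff.1 hk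
      obtain ⟨c, hc, hc', rfl⟩ := (hasEdge_iff hjk).1 hγ
      have hl : G.lower b < G.lower c := by rw [hb, hc]; exact Fin.succ_pos j
      have hu := hb'.trans hc'.symm
      obtain ⟨a, ha⟩ := h b c (fun h => hl.ne (h ▸ rfl)) hu
      obtain ⟨h₁, h₂, -⟩ := (mem_span_edgeForm_iff_of_lower_lt hl hu).1 ha
      exact hasZeroEdge_iff.2 ⟨a, h₁.trans hb, h₂.trans hc⟩

end LabeledMultigraph

/-! ### Atoms of the intersection lattice, and increasing forests -/

namespace LabeledMultigraph

open Module Submodule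

variable {n : ℕ} {E : Type*} (G : LabeledMultigraph n E)

theorem mem_arrangement_iff {H : Submodule ℂ (Fin n → ℂ)} :
    H ∈ G.arrangement ↔ ∃ e : G.edgeSet, H = LinearMap.ker (G.edgeForm e) := by
  constructor
  · rintro (⟨i, j, γ, hij, hγ, rfl⟩ | ⟨k, hk, rfl⟩)
    · obtain ⟨e, h₁, h₂, h₃⟩ := (hasEdge_iff hij).1 hγ
      exact ⟨e, by simp [edgeForm, binomialForm, h₁, h₂, h₃]⟩
    · obtain ⟨e, h₁, h₂⟩ := hasZeroEdge_iff.1 hk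
      exact ⟨e, by simp [edgeForm, binomialForm, h₁, h₂, coeff]⟩
  · rintro ⟨e, rfl⟩
    have hlt := G.lower_lt_upper e
    obtain ⟨k, hk⟩ := Fin.exists_succ_eq.2 (Fin.ne_zero_of_lt hlt)
    by_cases h : G.lower e = 0
    · exact Or.inr ⟨k, hasZeroEdge_iff.2 ⟨e, h, hk.symm⟩,
        by simp [edgeForm, binomialForm, h, ← hk, coeff]⟩
    · obtain ⟨j, hj⟩ := Fin.exists_succ_eq.2 h
      have hjk : j < k := by rwa [← hk, ← hj, Fin.succ_lt_succ_iff] at hlt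
      exact Or.inl ⟨j, k, G.coeff e, hjk, (hasEdge_iff hjk).2 ⟨e, hj.symm, hk.symm, rfl⟩,
        by simp [edgeForm, binomialForm, ← hj, ← hk]⟩

theorem isCoatom_of_mem_arrangement {H : Submodule ℂ (Fin n → ℂ)} (hH : H ∈ G.arrangement) :
    IsCoatom H := by
  obtain ⟨e, rfl⟩ := G.mem_arrangement_iff.1 hH
  exact LinearMap.isCoatom_ker_of_surjective (LinearMap.surjective (G.edgeForm_ne_zero e))

theorem finite_arrangement : G.arrangement.Finite := by
  have := G.edgeSet_finite.to_subtype
  refine (Set.finite_range fun e : G.edgeSet => LinearMap.ker (G.edgeForm e)).subset ?_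
  intro H hH
  obtain ⟨e, rfl⟩ := G.mem_arrangement_iff.1 hH
  exact ⟨e, rfl⟩

/-- The atom of the intersection lattice given by the hyperplane of an edge. -/
def atomOfEdge (e : G.edgeSet) : LatticeAtom G.lattice :=
  ⟨IntersectionLattice.ofMem (G.mem_arrangement_iff.2 ⟨e, rfl⟩),
    (IntersectionLattice.isAtom_iff_mem (fun _ => G.isCoatom_of_mem_arrangement) _).2
      (G.mem_arrangement_iff.2 ⟨e, rfl⟩)⟩

theorem atomOfEdge_bijective : Function.Bijective G.atomOfEdge := by
  constructor
  · intro e f h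
    have hker : LinearMap.ker (G.edgeForm e) = LinearMap.ker (G.edgeForm f) :=
      congrArg (fun a : LatticeAtom G.lattice => a.1.1) h
    apply eq_of_edgeForm_mem_span_singleton
    have := mem_span_of_iInf_ker_le_ker (L := fun _ : Unit => G.edgeForm f) (K := G.edgeForm e)
      (by simp [hker])
    simpa using this
  · rintro ⟨X, hX⟩
    have := (IntersectionLattice.isAtom_iff_mem (fun _ => G.isCoatom_of_mem_arrangement) X).1 hX
    obtain ⟨e, he⟩ := G.mem_arrangement_iff.1 this
    exact ⟨e, Subtype.ext (Subtype.ext he.symm)⟩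

/-- The atoms of the intersection lattice correspond to the edges. -/
def edgeEquivAtom : G.edgeSet ≃ LatticeAtom G.lattice :=
  Equiv.ofBijective G.atomOfEdge G.atomOfEdge_bijective

theorem coe_edgeEquivAtom (e : G.edgeSet) :
    (G.edgeEquivAtom e).1.1 = LinearMap.ker (G.edgeForm e) := rfl

variable {G} in
/-- The increasing spanning forests are the sets of edges in which every vertex is the larger end of
at most one edge. -/
theorem isIncreasingForest_restrict_image_iff (F : Set G.edgeSet) :
    (G.toGraph.restrict (Subtype.val '' F)).IsIncreasingForest ↔ Set.InjOn G.upper F := by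
  constructor
  · intro h e he f hf hef
    have he' := G.isLink_lower_upper e
    have hf' := G.isLink_lower_upper f
    rw [← hef] at hf'
    exact Subtype.ext (h.atMostOneLowerEdge e f _ _ _ (G.lower_lt_upper e)
      (hef ▸ G.lower_lt_upper f) ⟨⟨e, he, rfl⟩, he'⟩ ⟨⟨f, hf, rfl⟩, hf'⟩)
  · intro h
    refine Graph.AtMostOneLowerEdge.isIncreasingForest ?_ fun e x he => G.loopless e x he.2
    rintro _ _ x x' y hxy hx'y ⟨⟨e, he, rfl⟩, hle⟩ ⟨⟨f, hf, rfl⟩, hlf⟩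
    rw [h he hf ((lower_eq_and_upper_eq hxy hle).2.trans (lower_eq_and_upper_eq hx'y hlf).2.symm)]

theorem isf_eq_ncard (m : ℕ) : G.isf m =
    {S : Set (LatticeAtom G.lattice) |
      Set.InjOn (fun a => G.upper (G.edgeEquivAtom.symm a)) S ∧ S.encard = m}.ncard := by
  have hinj : Function.Injective fun S : Set (LatticeAtom G.lattice) =>
      (Subtype.val '' (G.edgeEquivAtom.symm '' S) : Set E) :=
    (Set.image_injective.2 Subtype.val_injective).comp
      (Set.image_injective.2 G.edgeEquivAtom.symm.injective)
  rw [isf, ← Set.ncard_image_of_injective _ hinj]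
  congr 1
  ext F
  simp only [Set.mem_image, Set.mem_ofPred_eq]
  constructor
  · rintro ⟨hF, hinc, hcard⟩
    obtain ⟨F, rfl⟩ := Set.subset_range_iff_exists_image_eq.1 (hF.trans_eq Subtype.range_coe.symm)
    have hF' : G.edgeEquivAtom.symm '' (G.edgeEquivAtom '' F) = F := by
      simp [Set.image_image]
    rw [isIncreasingForest_restrict_image_iff] at hinc
    rw [Subtype.val_injective.encard_image] at hcard
    refine ⟨G.edgeEquivAtom '' F, ⟨?_, ?_⟩, by rw [hF']⟩
    · rintro _ ⟨e, he, rfl⟩ _ ⟨f, hf, rfl⟩ h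
      simp only [Equiv.symm_apply_apply] at h
      rw [hinc he hf h]
    · rw [G.edgeEquivAtom.injective.encard_image, hcard]
  · rintro ⟨S, ⟨hS, hcard⟩, rfl⟩
    refine ⟨by rintro _ ⟨e, -, rfl⟩; exact e.2, ?_, ?_⟩
    · rw [isIncreasingForest_restrict_image_iff]
      exact hS.image_of_comp
    · rw [Subtype.val_injective.encard_image, G.edgeEquivAtom.symm.injective.encard_image, hcard]

end LabeledMultigraph

open LabeledMultigraph Submodule in
theorem corollary4p4 {n : ℕ} (hn : 0 < n) {E : Type*} (G : LabeledMultigraph n E)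
    (prec : LatticeAtom G.lattice → LatticeAtom G.lattice → Prop)
    (hprec : IsStrictTotalOrder (LatticeAtom G.lattice) prec) :
    (∀ m : ℕ, G.isf m ≤ nbcCount prec m) ∧
    ((∀ m : ℕ, G.isf m = nbcCount prec m) ↔ G.IsPerfectlyLabeled) := by
  have := G.edgeSet_finite.to_subtype
  have := Finite.of_equiv _ G.edgeEquivAtom
  set φ := G.edgeEquivAtom
  set v : LatticeAtom G.lattice → Module.Dual ℂ (Fin n → ℂ) := fun a => G.edgeForm (φ.symm a)
  have hnbc : ∀ m : ℕ, nbcCount prec m =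
      {S : Set (LatticeAtom G.lattice) | VectorNBC ℂ prec v S ∧ S.encard = m}.ncard := by
    intro m
    have hv : ∀ a, a.1.1 = LinearMap.ker (v a) := fun a => by
      rw [← G.coe_edgeEquivAtom, Equiv.apply_symm_apply]
    simp only [nbcCount, IntersectionLattice.isNBC_iff_vectorNBC prec G.finite_arrangement
      (fun H hH => (G.mem_arrangement_iff.1 hH).imp' G.edgeForm fun _ h => h) hv]
  have hlow : ∀ (b : LatticeAtom G.lattice) (T : Set (LatticeAtom G.lattice)),
      (∀ t ∈ T, G.upper (φ.symm t) < G.upper (φ.symm b)) → v b ∉ span ℂ (v '' T) := by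
    intro b T hT
    have := edgeForm_notMem_span (e := φ.symm b) (T := φ.symm '' T) 
      (by rintro _ ⟨t, ht, rfl⟩; exact hT t ht)
    rwa [Set.image_image] at this
  have hpar : ∀ a b, v a ∈ span ℂ {v b} → a = b := fun a b h =>
    φ.symm.injective (eq_of_edgeForm_mem_span_singleton h)
  obtain ⟨hle, heq⟩ := ncard_injOn_le_and_eq_iff prec hlow hpar
  simp only [hnbc, G.isf_eq_ncard]
  refine ⟨hle, heq.trans ?_⟩
  rw [isPerfectlyLabeled_iff]
  simp only [v, φ.symm.surjective.forall, φ.symm.surjective.exists, φ.symm.injective.ne_iff]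

end
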